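/- For each $n\ge 1$ let $X=X(n)$ be a random subset ("coupon") of $[n]=\{1,\dots,n\}$ whose law is invariant under every permutation of $[n]$ (that is, $X$ is exchangeable). Let $M=M(n)$ be the largest value that $|X|$ takes with positive probability, $\mu=\mu(n)=\mathbb E|X|$ and $\chi=\chi(n)=\mathbb E[|X|^2]$, and suppose that $\mu>0$ for all sufficiently large $n$. Let $X_1,X_2,\dots$ be i.i.d. copies of $X$, and let $$T=T(n)=\inf\Big\{t\in\{0,1,2,\dots\}:\ \bigcup_{i\le t}X_i=[n]\Big\}\in\{0,1,2,\dots\}\cup\{\infty\}$$ be the covering time. Here $f=o(g)$ means $f(n)/g(n)\to0$ as $n\to\infty$, and, for $f$ eventually positive, "with high probability $T=(1+o(1))f(n)$" means that for every $\varepsilon>0$, $\mathbb P\big(|T/f(n)-1|>\varepsilon\big)\to0$ as $n\to\infty$ (the event $T=\infty$ being included in $|T/f(n)-1|>\varepsilon$). Suppose that at least one of the following four conditions holds (as $n\to\infty$): (i) $M=o(\sqrt{n\log n})$; (ii) $M=o(n)$ and $M=o(\sqrt{\mu n\log n})$; (iii) $M=o(n)$ and $\chi=o(\mu n\log n)$;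 (iv) there is a constant $\delta>0$ such that $\mu<(1-\delta)n$ for all sufficiently large $n$, and $\chi=\Big(1+o\big(\tfrac{1}{\mu n\log n}\big)\Big)\mu^2$. Then with high probability $$T=(1+o(1))\,\frac{\log n}{-\log\left(1-\frac{\mu}{n}\right)}.$$ If moreover $\mu=o(n)$, then with high probability $T=(1+o(1))\,\dfrac{n\log n}{\mu}$. -/

import Mathlib

open MeasureTheory ProbabilityTheory Filter Topology Asymptotics

noncomputable section

namespace CouponCollector

/-- A random coupon `X` on `V` is exchangeable if its law is invariant under every
permutation of `V`. -/
def IsExchangeable {V Ω : Type*} [MeasurableSpace Ω] (X : Ω → Finset V) (P : Measure Ω) : Prop :=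
  ∀ σ : Equiv.Perm V, P.map (fun ω => (X ω).map σ.toEmbedding) = P.map X

/-- Maximum coupon size: the largest value that `|X|` takes with positive probability. -/
def maxSize {V Ω : Type*} [MeasurableSpace Ω] (X : Ω → Finset V) (P : Measure Ω) : ℕ :=
  sSup {k : ℕ | 0 < P {ω | (X ω).card = k}}

/-- Average coupon size. -/
def meanSize {V Ω : Type*} [MeasurableSpace Ω] (X : Ω → Finset V) (P : Measure Ω) : ℝ :=
  ∫ ω, ((X ω).card : ℝ) ∂P

/-- Mean square coupon size. -/
def meanSqSize {V Ω : Type*} [MeasurableSpace Ω] (X : Ω → Finset V) (P : Measure Ω) : ℝ :=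
  ∫ ω, ((X ω).card : ℝ) ^ 2 ∂P

/-- `X 0, X 1, X 2, …` are i.i.d. copies of the random coupon `X₀`
(`X i` is the `(i+1)`-st coupon received by the collector). -/
structure IsCouponSequence {V Ω₀ Ω : Type*} [MeasurableSpace Ω₀] [MeasurableSpace Ω]
    (X₀ : Ω₀ → Finset V) (P₀ : Measure Ω₀) (X : ℕ → Ω → Finset V) (P : Measure Ω) : Prop where
  identDistrib : ∀ i, IdentDistrib (X i) X₀ P P₀
  indep : iIndepFun X P

/-- The set of elements covered by the first `t` coupons. -/
def covered {V Ω : Type*} [DecidableEq V] (X : ℕ → Ω → Finset V) (t : ℕ) (ω : Ω) : Finset V :=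
  (Finset.range t).biUnion fun i => X i ω

/-- The covering time `T = inf {t : C_t = V}`, equal to `⊤` if `V` is never covered. -/
def coveringTime {V Ω : Type*} [Fintype V] [DecidableEq V] (X : ℕ → Ω → Finset V) (ω : Ω) : ℕ∞ :=
  ⨅ (t : ℕ) (_ : covered X t ω = Finset.univ), (t : ℕ∞)

/-- `Y n` is sharply concentrated around `f n`, i.e. `Y n / f n → 1` in probability, i.e.
with high probability `Y n = (1 + o(1)) f n`; the value `⊤` counts as far from `f n`. -/
def SharplyConcentrated {Ω : ℕ → Type*} [∀ n, MeasurableSpace (Ω n)] (P : ∀ n, Measure (Ω n))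
    (Y : ∀ n, Ω n → ℕ∞) (f : ℕ → ℝ) : Prop :=
  ∀ ε : ℝ, 0 < ε →
    Tendsto (fun n => P n {ω | Y n ω = ⊤ ∨ ε < |((Y n ω).toNat : ℝ) / f n - 1|}) atTop (𝓝 0)

end CouponCollector

end

/-! Each element avoids one coupon with probability `1 - μ/n`, so about `n (1 - μ/n)^t` elements are
uncovered at time `t`; this expectation crosses `1` at `t = log n / (-log (1 - μ/n))`.

The upper bound on `T` is Markov's inequality for the number of uncovered elements
(`measure_not_covered_le`). The lower bound is Chebyshev's inequality for a weighted count `Z`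
(`measure_covered_le`): an uncovered element `v` contributes `∏ g(|X_i|)`, so `Z = 0` once
everything is covered. By exchangeability only three moments of `|X|` matter: `a` and `b`, the first
and second moments of a one-coupon weight, and `c`, the mixed moment for two elements. The bound is
`(b/a²)^t / n + (c/a²)^t - 1`.

The weight `g` is chosen according to the hypothesis. In (i)-(iii), `M = o(n)`, and `g(k) = n/(n-k)`
cancels the chance that a coupon of size `k` avoids a given element. Fluctuations of coupon size
then leave the mean of `Z` unchanged, and what remains is the negative correlation between two
elements avoiding a coupon of fixed size: `c ≤ 1 = a`, with `b ≤ 1 + μ/(n-M)`. In (iv), `g = 1`, and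
the size fluctuations are controlled directly: `c/a² ≤ 1 + 2 Var|X| / (n-μ)²`. -/

namespace CouponCollector

/-! ### Weighted avoidance of an element by a coupon. -/

section Avoid

variable {V Ω : Type*} [DecidableEq V]

/-- The weight `g |s|` of a coupon `s` that avoids `v`, and `0` if `v ∈ s`. -/
def avoidWeight (g : ℕ → ℝ) (v : V) (s : Finset V) : ℝ := if v ∈ s then 0 else g s.card

lemma avoidWeight_map (g : ℕ → ℝ) (v : V) (s : Finset V) (σ : Equiv.Perm V) :
    avoidWeight g (σ v) (s.map σ.toEmbedding) = avoidWeight g v s := by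
  simp [avoidWeight]

lemma avoidWeight_mul_self (g : ℕ → ℝ) (v : V) (s : Finset V) :
    avoidWeight g v s * avoidWeight g v s = avoidWeight (fun k => g k ^ 2) v s := by
  by_cases hv : v ∈ s <;> simp [avoidWeight, hv, sq]

lemma mem_covered {X : ℕ → Ω → Finset V} {t : ℕ} {ω : Ω} {v : V} : v ∈ covered X t ω ↔ ∃ i < t, v ∈ X i ω := by
  simp [covered]

end Avoid

/-! ### Moments under exchangeability, and the first and second moment bounds. -/

section Moments

variable {V Ω₀ Ω : Type*} [Fintype V] [MeasurableSpace Ω₀] [MeasurableSpace Ω]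
  {P₀ : Measure Ω₀} {P : Measure Ω} {X₀ : Ω₀ → Finset V} {X : ℕ → Ω → Finset V}

/-- A function of a random finite subset of a finite type is integrable. -/
lemma integrable_comp_finset [IsProbabilityMeasure P₀] (hX₀ : AEMeasurable X₀ P₀)
    (F : Finset V → ℝ) : Integrable (fun ω => F (X₀ ω)) P₀ :=
  (Integrable.of_finite (μ := P₀.map X₀) (f := F)).comp_aemeasurable hX₀

/-- The expectation of a product over i.i.d. coupons is a power. -/
lemma integral_prod_coupons (hX : IsCouponSequence X₀ P₀ X P) (F : Finset V → ℝ) (t : ℕ) :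
    ∫ ω, ∏ i ∈ Finset.range t, F (X i ω) ∂P = (∫ ω, F (X₀ ω) ∂P₀) ^ t := by
  have hind : iIndepFun (fun i : Fin t => X i) P := hX.indep.precomp Fin.val_injective
  have h := hind.integral_fun_prod_comp (𝕜 := ℝ) (f := fun _ => F)
    (fun i => (hX.identDistrib i).aemeasurable_fst)
    (fun i => (measurable_of_countable F).aestronglyMeasurable)
  simp_rw [Finset.prod_range]
  rw [h]
  have h' : ∀ i : Fin t, ∫ ω, F (X i ω) ∂P = ∫ ω, F (X₀ ω) ∂P₀ := fun i =>
    ((hX.identDistrib i).comp (measurable_of_countable F)).integral_eq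
  simp [h']

/-- A product of functions of coupons is integrable. -/
lemma integrable_prod_coupons [IsProbabilityMeasure P] (hX : IsCouponSequence X₀ P₀ X P)
    (F : Finset V → ℝ) (t : ℕ) :
    Integrable (fun ω => ∏ i ∈ Finset.range t, F (X i ω)) P :=
  (Integrable.of_finite (μ := P.map fun ω (i : Fin t) => X i ω)
    (f := fun x => ∏ i, F (x i))).comp_aemeasurable
    (aemeasurable_pi_lambda _ fun i => (hX.identDistrib i).aemeasurable_fst) |>.congr
    (.of_forall fun ω => by simp [Finset.prod_range])

/-- Expectations of functions of an exchangeable coupon are permutation invariant. -/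
lemma IsExchangeable.integral_map_perm (hX₀ : AEMeasurable X₀ P₀) (hex : IsExchangeable X₀ P₀)
    (F : Finset V → ℝ) (σ : Equiv.Perm V) :
    ∫ ω, F ((X₀ ω).map σ.toEmbedding) ∂P₀ = ∫ ω, F (X₀ ω) ∂P₀ := by
  have hm : AEMeasurable (fun ω => (X₀ ω).map σ.toEmbedding) P₀ :=
    (measurable_of_countable fun s : Finset V => s.map σ.toEmbedding).comp_aemeasurable hX₀
  have hF : ∀ ν : Measure (Finset V), AEStronglyMeasurable F ν := fun ν =>
    (measurable_of_countable F).aestronglyMeasurable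
  rw [← integral_map (f := F) hm (hF _), hex σ, integral_map hX₀ (hF _)]

variable [DecidableEq V]

lemma sum_avoidWeight (g : ℕ → ℝ) (s : Finset V) :
    ∑ v, avoidWeight g v s = ((Fintype.card V : ℝ) - s.card) * g s.card := by
  have h : ∀ v, avoidWeight g v s = if v ∈ sᶜ then g s.card else 0 := fun v => by
    by_cases hv : v ∈ s <;> simp [avoidWeight, hv]
  simp_rw [h]
  rw [Finset.sum_ite_mem, Finset.univ_inter, Finset.sum_const, Finset.card_compl, nsmul_eq_mul,
    Nat.cast_sub (Finset.card_le_univ s)]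

/-- The right side is again an avoidance weight of `u`, with a modified `g`, so two-element moments
reduce to the one-element formula. -/
lemma sum_erase_avoidWeight_mul (g : ℕ → ℝ) (u : V) (s : Finset V) :
    ∑ v ∈ Finset.univ.erase u, avoidWeight g u s * avoidWeight g v s =
      avoidWeight (fun k => ((Fintype.card V : ℝ) - k - 1) * g k ^ 2) u s := by
  rw [← Finset.mul_sum]
  have h := Finset.add_sum_erase Finset.univ (fun v => avoidWeight g v s) (Finset.mem_univ u)
  rw [sum_avoidWeight] at h
  by_cases hu : u ∈ s
  · simp [avoidWeight, hu]
  · have hg : avoidWeight g u s = g s.card := by simp [avoidWeight, hu]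
    rw [hg] at h ⊢
    rw [eq_sub_of_add_eq' h]
    simp only [avoidWeight, hu, if_false]
    ring

variable [IsProbabilityMeasure P₀]

/-- Transpositions make the expectation independent of the element, so the left side is the
expectation of a sum over all elements, which depends on `|X₀|` alone. -/
lemma card_mul_integral_avoidWeight (hX₀ : AEMeasurable X₀ P₀) (hex : IsExchangeable X₀ P₀)
    (g : ℕ → ℝ) (v : V) :
    (Fintype.card V : ℝ) * ∫ ω, avoidWeight g v (X₀ ω) ∂P₀ =
      ∫ ω, ((Fintype.card V : ℝ) - (X₀ ω).card) * g (X₀ ω).card ∂P₀ := by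
  have h : ∀ w, ∫ ω, avoidWeight g w (X₀ ω) ∂P₀ = ∫ ω, avoidWeight g v (X₀ ω) ∂P₀ := fun w => by
    rw [← hex.integral_map_perm hX₀ (avoidWeight g w) (Equiv.swap v w)]
    refine integral_congr_ae (.of_forall fun ω => ?_)
    have := avoidWeight_map g v (X₀ ω) (Equiv.swap v w)
    rwa [Equiv.swap_apply_left] at this
  simp_rw [← sum_avoidWeight]
  rw [integral_finsetSum _ fun w _ => integrable_comp_finset hX₀ (avoidWeight g w)]
  simp [h]

lemma card_mul_integral_avoidWeight_mul (hX₀ : AEMeasurable X₀ P₀)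
    (hex : IsExchangeable X₀ P₀) (g : ℕ → ℝ) {u v : V} (huv : v ≠ u) :
    (Fintype.card V : ℝ) * (Fintype.card V - 1) *
        ∫ ω, avoidWeight g u (X₀ ω) * avoidWeight g v (X₀ ω) ∂P₀ =
      ∫ ω, ((Fintype.card V : ℝ) - (X₀ ω).card) *
        (((Fintype.card V : ℝ) - (X₀ ω).card - 1) * g (X₀ ω).card ^ 2) ∂P₀ := by
  have h : ∀ w ∈ Finset.univ.erase u,
      ∫ ω, avoidWeight g u (X₀ ω) * avoidWeight g w (X₀ ω) ∂P₀ =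
        ∫ ω, avoidWeight g u (X₀ ω) * avoidWeight g v (X₀ ω) ∂P₀ := fun w hw => by
    have hwu : w ≠ u := Finset.ne_of_mem_erase hw
    rw [← hex.integral_map_perm hX₀ (fun s => avoidWeight g u s * avoidWeight g w s)
      (Equiv.swap v w)]
    -- The transposition of `v` and `w` fixes `u`, so it moves only the second element of the pair.
    refine integral_congr_ae (.of_forall fun ω => ?_)
    have h1 := avoidWeight_map g v (X₀ ω) (Equiv.swap v w)
    have h2 := avoidWeight_map g u (X₀ ω) (Equiv.swap v w)
    rw [Equiv.swap_apply_left] at h1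
    rw [Equiv.swap_apply_of_ne_of_ne huv.symm hwu.symm] at h2
    simp only [h1, h2]
  refine Eq.trans ?_ (card_mul_integral_avoidWeight hX₀ hex
    (fun k => ((Fintype.card V : ℝ) - k - 1) * g k ^ 2) u)
  simp_rw [← sum_erase_avoidWeight_mul]
  rw [integral_finsetSum _ fun w _ => integrable_comp_finset hX₀
    (fun s => avoidWeight g u s * avoidWeight g w s), Finset.sum_congr rfl h, Finset.sum_const,
    Finset.card_erase_of_mem (Finset.mem_univ u), Finset.card_univ, nsmul_eq_mul,
    Nat.cast_sub (Fintype.card_pos_iff.mpr ⟨u⟩), Nat.cast_one, mul_assoc]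

/-- First moment bound: the probability that some element is not covered. -/
lemma measure_not_covered_le [IsProbabilityMeasure P] [Nonempty V]
    (hX : IsCouponSequence X₀ P₀ X P) (hex : IsExchangeable X₀ P₀) (t : ℕ) :
    P {ω | covered X t ω ≠ Finset.univ} ≤
      ENNReal.ofReal (Fintype.card V * (1 - meanSize X₀ P₀ / Fintype.card V) ^ t) := by
  have hX₀ : AEMeasurable X₀ P₀ := (hX.identDistrib 0).aemeasurable_snd
  have hn : (0 : ℝ) < Fintype.card V := by exact_mod_cast Fintype.card_pos
  set F : V → Finset V → ℝ := avoidWeight fun _ => 1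
  have hF : ∀ v, ∫ ω, F v (X₀ ω) ∂P₀ = 1 - meanSize X₀ P₀ / Fintype.card V := fun v => by
    have h := card_mul_integral_avoidWeight hX₀ hex (fun _ => 1) v
    simp_rw [mul_one] at h
    rw [integral_sub (integrable_const _) (integrable_comp_finset hX₀ fun s => (s.card : ℝ))] at h
    simp only [integral_const, probReal_univ, smul_eq_mul, one_mul] at h
    rw [meanSize, eq_sub_iff_add_eq]
    field_simp
    linarith
  have hF0 : ∀ v s, 0 ≤ F v s := fun v s => by
    simp only [F, avoidWeight]; split_ifs <;> norm_num
  have hsum : ∫ ω, ∑ v, ∏ i ∈ Finset.range t, F v (X i ω) ∂P =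
      Fintype.card V * (1 - meanSize X₀ P₀ / Fintype.card V) ^ t := by
    rw [integral_finsetSum _ fun v _ => ?_]
    · simp_rw [integral_prod_coupons hX, hF]
      simp
    · exact integrable_prod_coupons hX (F v) t
  rw [← hsum]
  have hint : Integrable (fun ω => ∑ v, ∏ i ∈ Finset.range t, F v (X i ω)) P :=
    integrable_finsetSum _ fun v _ => integrable_prod_coupons hX (F v) t
  have hnn : ∀ ω, 0 ≤ ∑ v, ∏ i ∈ Finset.range t, F v (X i ω) := fun ω =>
    Finset.sum_nonneg fun v _ => Finset.prod_nonneg fun i _ => hF0 _ _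
  rw [ofReal_integral_eq_lintegral_ofReal hint (.of_forall hnn)]
  have hsub : {ω | covered X t ω ≠ Finset.univ} ⊆
      {ω | 1 ≤ ENNReal.ofReal (∑ v, ∏ i ∈ Finset.range t, F v (X i ω))} := by
    intro ω hω
    obtain ⟨v, hv⟩ : ∃ v, v ∉ covered X t ω := by
      by_contra! h
      exact hω (Finset.eq_univ_iff_forall.mpr h)
    rw [Set.mem_ofPred_eq, ENNReal.one_le_ofReal]
    refine le_trans (le_of_eq ?_) (Finset.single_le_sum
      (f := fun v => ∏ i ∈ Finset.range t, F v (X i ω))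
      (fun w _ => Finset.prod_nonneg fun i _ => hF0 _ _) (Finset.mem_univ v))
    refine (Finset.prod_eq_one fun i hi => ?_).symm
    have : v ∉ X i ω := fun h => hv (mem_covered.mpr ⟨i, Finset.mem_range.mp hi, h⟩)
    simp [F, avoidWeight, this]
  refine (measure_mono hsub).trans ?_
  have := mul_meas_ge_le_lintegral₀ (μ := P) hint.aemeasurable.ennreal_ofReal 1
  simpa using this

/-- Weighted second moment bound for the probability that all elements are covered. -/
lemma measure_covered_le [IsProbabilityMeasure P] (hn : 2 ≤ Fintype.card V)
    (hX : IsCouponSequence X₀ P₀ X P) (hex : IsExchangeable X₀ P₀) (g : ℕ → ℝ) {a b c : ℝ}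
    (ha : 0 < a)
    (ha' : ∫ ω, ((Fintype.card V : ℝ) - (X₀ ω).card) * g (X₀ ω).card ∂P₀ = Fintype.card V * a)
    (hb : ∫ ω, ((Fintype.card V : ℝ) - (X₀ ω).card) * g (X₀ ω).card ^ 2 ∂P₀ =
      Fintype.card V * b)
    (hc0 : 0 ≤ c)
    (hc : ∫ ω, ((Fintype.card V : ℝ) - (X₀ ω).card) *
        (((Fintype.card V : ℝ) - (X₀ ω).card - 1) * g (X₀ ω).card ^ 2) ∂P₀ =
      Fintype.card V * (Fintype.card V - 1) * c) (t : ℕ) :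
    P {ω | covered X t ω = Finset.univ} ≤
      ENNReal.ofReal ((b / a ^ 2) ^ t / Fintype.card V + ((c / a ^ 2) ^ t - 1)) := by
  have hX₀ : AEMeasurable X₀ P₀ := (hX.identDistrib 0).aemeasurable_snd
  set n : ℝ := (Fintype.card V : ℝ) with hndef
  have hn2 : (2 : ℝ) ≤ n := by rw [hndef]; exact_mod_cast hn
  have hn0 : 0 < n := by linarith
  set Z : Ω → ℝ := fun ω => ∑ v, ∏ i ∈ Finset.range t, avoidWeight g v (X i ω) with hZ
  have hint : ∀ F : Finset V → ℝ, Integrable (fun ω => ∏ i ∈ Finset.range t, F (X i ω)) P :=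
    fun F => integrable_prod_coupons hX F t
  have h1 : ∀ v, ∫ ω, avoidWeight g v (X₀ ω) ∂P₀ = a := fun v =>
    mul_left_cancel₀ hn0.ne' ((card_mul_integral_avoidWeight hX₀ hex g v).trans ha')
  have h2 : ∀ v, ∫ ω, avoidWeight g v (X₀ ω) * avoidWeight g v (X₀ ω) ∂P₀ = b := fun v => by
    simp_rw [avoidWeight_mul_self]
    exact mul_left_cancel₀ hn0.ne' ((card_mul_integral_avoidWeight hX₀ hex _ v).trans hb)
  have h3 : ∀ u v, v ≠ u → ∫ ω, avoidWeight g u (X₀ ω) * avoidWeight g v (X₀ ω) ∂P₀ = c :=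
    fun u v huv => mul_left_cancel₀ (mul_ne_zero hn0.ne' (by linarith : n - 1 ≠ 0))
      ((card_mul_integral_avoidWeight_mul hX₀ hex g huv).trans hc)
  have hEZ : ∫ ω, Z ω ∂P = n * a ^ t := by
    rw [hZ, integral_finsetSum _ fun v _ => hint _]
    simp_rw [integral_prod_coupons hX, h1]
    simp [hndef]
  have hZsq : ∀ ω, Z ω ^ 2 = ∑ u, ∑ v, ∏ i ∈ Finset.range t,
      (avoidWeight g u (X i ω) * avoidWeight g v (X i ω)) := fun ω => by
    simp_rw [hZ, sq, Finset.sum_mul_sum, Finset.prod_mul_distrib]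
  have hEZ2 : ∫ ω, Z ω ^ 2 ∂P ≤ n * (b ^ t + n * c ^ t) := by
    simp_rw [hZsq]
    rw [integral_finsetSum _ fun u _ => integrable_finsetSum _ fun v _ => hint
      fun s => avoidWeight g u s * avoidWeight g v s]
    have hu : ∀ u ∈ Finset.univ, ∫ ω, ∑ v, ∏ i ∈ Finset.range t,
        (avoidWeight g u (X i ω) * avoidWeight g v (X i ω)) ∂P ≤ b ^ t + n * c ^ t := fun u _ => by
      rw [integral_finsetSum _ fun v _ => hint fun s => avoidWeight g u s * avoidWeight g v s]
      simp_rw [fun v => integral_prod_coupons hX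
        (fun s => avoidWeight g u s * avoidWeight g v s) t]
      rw [← Finset.add_sum_erase _ _ (Finset.mem_univ u), h2,
        Finset.sum_congr rfl fun v hv => by rw [h3 u v (Finset.ne_of_mem_erase hv)],
        Finset.sum_const, nsmul_eq_mul]
      -- Replacing `n - 1` by `n` in front of `c ^ t` is where `0 ≤ c` is needed.
      have : ((Finset.univ.erase u).card : ℝ) ≤ n := by
        rw [hndef]; exact_mod_cast Finset.card_le_univ _
      gcongr
    refine (Finset.sum_le_sum hu).trans (le_of_eq ?_)
    rw [Finset.sum_const, nsmul_eq_mul, Finset.card_univ]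
  have hmem : MemLp Z 2 P := by
    rw [memLp_two_iff_integrable_sq
      (integrable_finsetSum _ fun v _ => hint (avoidWeight g v)).aestronglyMeasurable]
    exact (integrable_finsetSum _ fun u _ => integrable_finsetSum _ fun v _ => hint
      fun s => avoidWeight g u s * avoidWeight g v s).congr (.of_forall fun ω => (hZsq ω).symm)
  have hpos : 0 < n * a ^ t := by positivity
  have hsub : {ω | covered X t ω = Finset.univ} ⊆ {ω | n * a ^ t ≤ |Z ω - ∫ x, Z x ∂P|} := by
    intro ω hω
    -- A covered element has a zero factor at the coupon containing it, whatever the other weights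
    -- are.
    have hZ0 : Z ω = 0 := Finset.sum_eq_zero fun v _ => by
      obtain ⟨i, hi, hv⟩ := mem_covered.mp ((Finset.eq_univ_iff_forall.mp hω) v)
      exact Finset.prod_eq_zero (Finset.mem_range.mpr hi) (by simp [avoidWeight, hv])
    rw [Set.mem_ofPred_eq, hEZ, hZ0, zero_sub, abs_neg, abs_of_pos hpos]
  refine (measure_mono hsub).trans ((meas_ge_le_variance_div_sq hmem hpos).trans ?_)
  refine ENNReal.ofReal_le_ofReal ?_
  rw [variance_eq_sub hmem, hEZ, div_le_iff₀ (by positivity)]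
  have heq : ((b / a ^ 2) ^ t / n + ((c / a ^ 2) ^ t - 1)) * (n * a ^ t) ^ 2 =
      n * (b ^ t + n * c ^ t) - (n * a ^ t) ^ 2 := by
    rw [div_pow, div_pow, ← pow_mul, mul_comm 2 t, pow_mul]
    field_simp
    ring
  rw [heq]
  have : (P[Z ^ 2] : ℝ) = ∫ ω, Z ω ^ 2 ∂P := rfl
  linarith

end Moments

lemma meanSize_nonneg {V Ω₀ : Type*} [MeasurableSpace Ω₀] {P₀ : Measure Ω₀}
    {X₀ : Ω₀ → Finset V} : 0 ≤ meanSize X₀ P₀ :=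
  integral_nonneg fun _ => Nat.cast_nonneg _

/-! ### Explicit bounds on early covering for the two choices of weight. -/

section Bounds

variable {V Ω₀ Ω : Type*} [Fintype V] [MeasurableSpace Ω₀] [MeasurableSpace Ω]
  {P₀ : Measure Ω₀} {P : Measure Ω} {X₀ : Ω₀ → Finset V} {X : ℕ → Ω → Finset V}

lemma ae_card_le_maxSize : ∀ᵐ ω ∂P₀, (X₀ ω).card ≤ maxSize X₀ P₀ := by
  have h : ∀ᵐ ω ∂P₀, ∀ k : ℕ, maxSize X₀ P₀ < k → (X₀ ω).card ≠ k := by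
    rw [ae_all_iff]
    intro k
    by_cases hk : maxSize X₀ P₀ < k
    -- `sSup` on `ℕ` is an upper bound only for a bounded set; the size of `V` is a bound here.
    · have hbdd : BddAbove {k : ℕ | 0 < P₀ {ω | (X₀ ω).card = k}} := by
        refine ⟨Fintype.card V, fun k hk => ?_⟩
        obtain ⟨ω, hω⟩ := nonempty_of_measure_ne_zero (ne_of_gt hk)
        exact (show (X₀ ω).card = k from hω) ▸ Finset.card_le_univ _
      have h0 : P₀ {ω | (X₀ ω).card = k} = 0 := by
        by_contra h0
        exact absurd (le_csSup hbdd (pos_iff_ne_zero.mpr h0 :)) (not_le.mpr hk)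
      filter_upwards [measure_eq_zero_iff_ae_notMem.mp h0] with ω hω _ using hω
    · exact .of_forall fun _ h => absurd h hk
  filter_upwards [h] with ω hω
  by_contra hlt
  exact hω _ (not_le.mp hlt) rfl

lemma meanSize_le_maxSize [IsProbabilityMeasure P₀] (hX₀ : AEMeasurable X₀ P₀) :
    meanSize X₀ P₀ ≤ maxSize X₀ P₀ := by
  have h := integral_mono_ae (integrable_comp_finset hX₀ fun s => (s.card : ℝ))
    (integrable_const (maxSize X₀ P₀ : ℝ))
    (ae_card_le_maxSize.mono fun ω hω => Nat.cast_le.mpr hω)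
  simpa [meanSize] using h

lemma integral_quadratic_card [IsProbabilityMeasure P₀] (hX₀ : AEMeasurable X₀ P₀) (A B : ℝ) :
    ∫ ω, (A + B * (X₀ ω).card + ((X₀ ω).card : ℝ) ^ 2) ∂P₀ =
      A + B * meanSize X₀ P₀ + meanSqSize X₀ P₀ := by
  have hint := (integrable_comp_finset hX₀ fun s => (s.card : ℝ)).const_mul B
  have hint1 : Integrable (fun ω => A + B * ((X₀ ω).card : ℝ)) P₀ := (integrable_const A).add hint
  rw [integral_add hint1 (integrable_comp_finset hX₀ fun s => (s.card : ℝ) ^ 2),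
    integral_add (integrable_const A) hint, integral_const_mul]
  simp [meanSize, meanSqSize]

lemma meanSize_sq_le [IsProbabilityMeasure P₀] (hX₀ : AEMeasurable X₀ P₀) :
    meanSize X₀ P₀ ^ 2 ≤ meanSqSize X₀ P₀ := by
  have h := integral_quadratic_card hX₀ (meanSize X₀ P₀ ^ 2) (-2 * meanSize X₀ P₀)
  have h0 : 0 ≤ ∫ ω, (meanSize X₀ P₀ ^ 2 + -2 * meanSize X₀ P₀ * (X₀ ω).card
      + ((X₀ ω).card : ℝ) ^ 2) ∂P₀ :=
    integral_nonneg fun ω => by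
      have : (0 : ℝ) ≤ ((X₀ ω).card - meanSize X₀ P₀) ^ 2 := sq_nonneg _
      simp only [Pi.zero_apply]
      linarith
  rw [h] at h0
  linarith

variable [DecidableEq V] [IsProbabilityMeasure P₀] [IsProbabilityMeasure P]

/-- Bound for the probability of early covering when coupons are never the full set. -/
lemma measure_covered_le_of_maxSize_lt (hn : 2 ≤ Fintype.card V)
    (hX : IsCouponSequence X₀ P₀ X P) (hex : IsExchangeable X₀ P₀)
    (hM : maxSize X₀ P₀ < Fintype.card V) (t : ℕ) :
    P {ω | covered X t ω = Finset.univ} ≤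
      ENNReal.ofReal (Real.exp (t * (meanSize X₀ P₀ / (Fintype.card V - maxSize X₀ P₀))) /
        Fintype.card V) := by
  have hX₀ : AEMeasurable X₀ P₀ := (hX.identDistrib 0).aemeasurable_snd
  set n : ℝ := (Fintype.card V : ℝ) with hndef
  set m : ℝ := (maxSize X₀ P₀ : ℝ) with hmdef
  have hn2 : (2 : ℝ) ≤ n := by rw [hndef]; exact_mod_cast hn
  have hn0 : 0 < n := by linarith
  have hn1 : 0 < n - 1 := by linarith
  have hmn : 0 < n - m := by rw [hndef, hmdef, sub_pos]; exact_mod_cast hM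
  have hK : ∀ᵐ ω ∂P₀, 0 ≤ ((X₀ ω).card : ℝ) ∧ ((X₀ ω).card : ℝ) ≤ m ∧
      ((X₀ ω).card : ℝ) + 1 ≤ n := by
    filter_upwards [ae_card_le_maxSize (X₀ := X₀) (P₀ := P₀)] with ω hω
    exact ⟨Nat.cast_nonneg _, Nat.cast_le.mpr hω, by
      rw [hndef]; exact_mod_cast (hω.trans_lt hM)⟩
  -- A coupon of size `k` avoids a given element with probability `(n - k) / n`; `g` is the inverse,
  -- so the mean weight is `a = 1`.
  set g : ℕ → ℝ := fun k => n / (n - k) with hg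
  set b : ℝ := (∫ ω, (n - (X₀ ω).card) * g (X₀ ω).card ^ 2 ∂P₀) / n with hb
  set c : ℝ := (∫ ω, (n - (X₀ ω).card) * ((n - (X₀ ω).card - 1) * g (X₀ ω).card ^ 2) ∂P₀) /
    (n * (n - 1)) with hc
  have ha : ∫ ω, (n - (X₀ ω).card) * g (X₀ ω).card ∂P₀ = n * 1 := by
    rw [integral_congr_ae (g := fun _ => n)]
    · simp
    · filter_upwards [hK] with ω hω
      have : n - (X₀ ω).card ≠ 0 := by linarith
      simp only [hg]
      field_simp
  have hc0 : 0 ≤ c := by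
    refine div_nonneg (integral_nonneg_of_ae ?_) (by positivity)
    filter_upwards [hK] with ω hω
    exact mul_nonneg (by linarith) (mul_nonneg (by linarith) (sq_nonneg _))
  have hc1 : c ≤ 1 := by
    rw [hc, div_le_one (by positivity)]
    have h := integral_mono_ae (integrable_comp_finset hX₀
        fun s => (n - s.card) * ((n - s.card - 1) * g s.card ^ 2))
      (integrable_const (n * (n - 1))) (by
        filter_upwards [hK] with ω ⟨h0, _, h1⟩
        have hd : 0 < n - (X₀ ω).card := by linarith
        simp only [hg]
        rw [show (n - ((X₀ ω).card : ℝ)) * ((n - (X₀ ω).card - 1) * (n / (n - (X₀ ω).card)) ^ 2)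
          = n * (n * (n - (X₀ ω).card - 1)) / (n - (X₀ ω).card) by field_simp,
          div_le_iff₀ hd, mul_assoc]
        refine mul_le_mul_of_nonneg_left ?_ hn0.le
        -- What remains is `n (n - k - 1) ≤ (n - 1) (n - k)`, that is, `0 ≤ k`.
        nlinarith)
    simpa using h
  have hb1 : b ≤ 1 + meanSize X₀ P₀ / (n - m) := by
    rw [hb, div_le_iff₀ hn0]
    have hint := integrable_comp_finset hX₀ fun s => (s.card : ℝ)
    have h := integral_mono_ae (integrable_comp_finset hX₀ fun s => (n - s.card) * g s.card ^ 2)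
      ((integrable_const n).add (hint.const_mul (n / (n - m)))) (by
        filter_upwards [hK] with ω ⟨h0, h1, h2⟩
        have hd : 0 < n - (X₀ ω).card := by linarith
        simp only [hg, Pi.add_apply]
        rw [show (n - ((X₀ ω).card : ℝ)) * (n / (n - (X₀ ω).card)) ^ 2
          = n + n / (n - (X₀ ω).card) * (X₀ ω).card by field_simp; ring]
        gcongr)
    refine h.trans (le_of_eq ?_)
    rw [integral_add' (integrable_const n) (hint.const_mul _), integral_const_mul]
    simp only [integral_const, probReal_univ, smul_eq_mul, one_mul, meanSize]
    ring
  have hb0 : 0 ≤ b := by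
    refine div_nonneg (integral_nonneg_of_ae ?_) hn0.le
    filter_upwards [hK] with ω hω
    exact mul_nonneg (by linarith) (sq_nonneg _)
  refine (measure_covered_le hn hX hex g one_pos ha (mul_div_cancel₀ _ hn0.ne').symm hc0
    (mul_div_cancel₀ _ (by positivity)).symm t).trans (ENNReal.ofReal_le_ofReal ?_)
  have h1 : b ^ t ≤ Real.exp (t * (meanSize X₀ P₀ / (n - m))) := by
    rw [Real.exp_nat_mul]
    have := Real.add_one_le_exp (meanSize X₀ P₀ / (n - m))
    exact pow_le_pow_left₀ hb0 (by linarith) t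
  have h2 : c ^ t ≤ 1 := pow_le_one₀ hc0 hc1
  have h3 : b ^ t / n ≤ Real.exp (t * (meanSize X₀ P₀ / (n - m))) / n := by gcongr
  simp only [one_pow, div_one]
  linarith

/-- Bound for the probability of early covering in terms of the variance of the coupon size. -/
lemma measure_covered_le_of_variance (hn : 2 ≤ Fintype.card V)
    (hX : IsCouponSequence X₀ P₀ X P) (hex : IsExchangeable X₀ P₀)
    (hμ : meanSize X₀ P₀ < Fintype.card V) (t : ℕ) :
    P {ω | covered X t ω = Finset.univ} ≤
      ENNReal.ofReal (((1 - meanSize X₀ P₀ / Fintype.card V)⁻¹) ^ t / Fintype.card V +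
        (Real.exp (t * (2 * (meanSqSize X₀ P₀ - meanSize X₀ P₀ ^ 2) /
          (Fintype.card V - meanSize X₀ P₀) ^ 2)) - 1)) := by
  have hX₀ : AEMeasurable X₀ P₀ := (hX.identDistrib 0).aemeasurable_snd
  have hvar := meanSize_sq_le hX₀
  have hμ0 : 0 ≤ meanSize X₀ P₀ := meanSize_nonneg
  set n : ℝ := (Fintype.card V : ℝ) with hndef
  set μ := meanSize X₀ P₀ with hμdef
  set χ := meanSqSize X₀ P₀ with hχdef
  have hn2 : (2 : ℝ) ≤ n := by rw [hndef]; exact_mod_cast hn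
  have hn0 : 0 < n := by linarith
  have hn1 : 0 < n - 1 := by linarith
  have hd : 0 < n - μ := by linarith
  have hint := integrable_comp_finset hX₀ fun s => (s.card : ℝ)
  have hint2 := integrable_comp_finset hX₀ fun s => (s.card : ℝ) ^ 2
  set a : ℝ := 1 - μ / n with ha
  have ha0 : 0 < a := by
    rw [ha, sub_pos, div_lt_one hn0]; exact hμ
  have ha1 : n * a = n - μ := by rw [ha]; field_simp
  have hI : ∫ ω, (n - (X₀ ω).card) ∂P₀ = n * a := by
    rw [integral_sub (integrable_const _) hint, ha1]
    simp [hμdef, meanSize]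
  set c : ℝ := (n ^ 2 - n - (2 * n - 1) * μ + χ) / (n * (n - 1)) with hc
  have hI2 : ∫ ω, (n - (X₀ ω).card) * (n - (X₀ ω).card - 1) ∂P₀ = n * (n - 1) * c := by
    have h : ∀ ω, (n - ((X₀ ω).card : ℝ)) * (n - (X₀ ω).card - 1) =
        n ^ 2 - n + -(2 * n - 1) * (X₀ ω).card + ((X₀ ω).card : ℝ) ^ 2 := fun ω => by ring
    simp_rw [h]
    rw [integral_quadratic_card hX₀, hc, mul_div_cancel₀ _ (by positivity)]
    ring
  have hc0 : 0 ≤ c := by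
    refine nonneg_of_mul_nonneg_right (a := n * (n - 1)) ?_ (by positivity)
    rw [← hI2]
    refine integral_nonneg fun ω => ?_
    have hle : (X₀ ω).card ≤ Fintype.card V := Finset.card_le_univ _
    obtain ⟨j, hj⟩ := Nat.exists_eq_add_of_le hle
    have : n - ((X₀ ω).card : ℝ) = j := by rw [hndef, hj]; push_cast; ring
    simp only [this, Pi.zero_apply]
    -- `j (j - 1)` is nonnegative because `j` is a natural number; a real `j` in `(0, 1)` would
    -- fail.
    rcases Nat.eq_zero_or_pos j with rfl | hj0
    · simp
    · have : (1 : ℝ) ≤ j := by exact_mod_cast hj0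
      exact mul_nonneg (by linarith) (by linarith)
  have hca : c / a ^ 2 ≤ 1 + 2 * (χ - μ ^ 2) / (n - μ) ^ 2 := by
    have ha2 : a = (n - μ) / n := by rw [← ha1]; field_simp
    rw [ha2, div_pow, hc, div_div_div_eq, div_le_iff₀ (by positivity)]
    have e : (1 + 2 * (χ - μ ^ 2) / (n - μ) ^ 2) * (n * (n - 1) * (n - μ) ^ 2) =
        n * (n - 1) * ((n - μ) ^ 2 + 2 * (χ - μ ^ 2)) := by field_simp
    rw [e, mul_comm _ (n ^ 2), sq n, mul_assoc, mul_assoc n (n - 1)]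
    refine mul_le_mul_of_nonneg_left ?_ hn0.le
    -- The two sides differ by exactly `μ (n - μ) + (n - 2) (χ - μ²)`. The constant 2 absorbs `n /
    -- (n - 1)`, which is at most 2.
    nlinarith [mul_nonneg hμ0 hd.le, mul_nonneg (by linarith : 0 ≤ n - 2) (sub_nonneg.mpr hvar)]
  refine (measure_covered_le (b := a) hn hX hex (fun _ => 1) ha0 (by simpa using hI)
    (by simpa using hI) hc0 (by simpa using hI2) t).trans (ENNReal.ofReal_le_ofReal ?_)
  have e1 : a / a ^ 2 = a⁻¹ := by field_simp
  rw [e1, Real.exp_nat_mul]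
  have h1 : (c / a ^ 2) ^ t ≤ Real.exp (2 * (χ - μ ^ 2) / (n - μ) ^ 2) ^ t :=
    pow_le_pow_left₀ (by positivity) (hca.trans (by
      linarith [Real.add_one_le_exp (2 * (χ - μ ^ 2) / (n - μ) ^ 2)])) t
  linarith

end Bounds

/-! ### From covering probabilities to concentration of the covering time. -/

section CoveringTime

variable {V Ω : Type*} [Fintype V] [DecidableEq V] {X : ℕ → Ω → Finset V} {ω : Ω} {t : ℕ}

lemma coveringTime_le (h : covered X t ω = Finset.univ) : coveringTime X ω ≤ t :=
  iInf₂_le t h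

lemma covered_of_coveringTime_le (h : coveringTime X ω ≤ t) : covered X t ω = Finset.univ := by
  by_contra hne
  -- Coverage is monotone in time, so if `t` fails then every covering time is at least `t + 1`;
  -- attainment of the infimum is not needed.
  have hlt : ((t + 1 : ℕ) : ℕ∞) ≤ coveringTime X ω := by
    refine le_iInf₂ fun s hs => Nat.cast_le.mpr ?_
    by_contra hst
    refine hne (Finset.eq_univ_iff_forall.mpr fun v => ?_)
    obtain ⟨i, hi, hv⟩ := mem_covered.mp ((Finset.eq_univ_iff_forall.mp hs) v)
    exact mem_covered.mpr ⟨i, by omega, hv⟩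
  have := Nat.cast_le.mp (hlt.trans h)
  omega

end CoveringTime

/-- Concentration of the covering time follows from covering shortly after `f n` and
not covering shortly before `f n`. -/
lemma sharplyConcentrated_coveringTime {V Ω : ℕ → Type*} [∀ n, Fintype (V n)]
    [∀ n, DecidableEq (V n)] [∀ n, MeasurableSpace (Ω n)] {P : ∀ n, Measure (Ω n)}
    {X : ∀ n, ℕ → Ω n → Finset (V n)} {f : ℕ → ℝ} (hf : ∀ᶠ n in atTop, 0 < f n)
    (hupper : ∀ ε : ℝ, 0 < ε → Tendsto
      (fun n => P n {ω | covered (X n) ⌊(1 + ε) * f n⌋₊ ω ≠ Finset.univ}) atTop (𝓝 0))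
    (hlower : ∀ ε : ℝ, 0 < ε → ε < 1 → Tendsto
      (fun n => P n {ω | covered (X n) ⌊(1 - ε) * f n⌋₊ ω = Finset.univ}) atTop (𝓝 0)) :
    SharplyConcentrated P (fun n => coveringTime (X n)) f := by
  intro ε hε
  -- The lower estimate is available only below 1, and shrinking `ε` there only enlarges the event.
  set ε' : ℝ := min ε (1 / 2)
  have hε' : 0 < ε' := lt_min hε (by norm_num)
  have hε1 : ε' < 1 := (min_le_right _ _).trans_lt (by norm_num)
  have hlim := (hupper ε hε).add (hlower ε' hε' hε1)
  rw [add_zero] at hlim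
  refine tendsto_of_tendsto_of_tendsto_of_le_of_le' tendsto_const_nhds hlim
    (.of_forall fun _ => zero_le) ?_
  filter_upwards [hf] with n hfn
  refine (measure_mono fun ω hω => ?_).trans (measure_union_le _ _)
  by_cases hc : covered (X n) ⌊(1 + ε) * f n⌋₊ ω = Finset.univ
  · right
    have hT := coveringTime_le hc
    have hfin : coveringTime (X n) ω ≠ ⊤ := ne_top_of_le_ne_top (ENat.natCast_ne_top _) hT
    obtain ⟨s, hs⟩ := ENat.ne_top_iff_exists.mp hfin
    have hdev : ε < |(s : ℝ) / f n - 1| := by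
      rcases hω with h | h
      · exact absurd h hfin
      · simpa [← hs] using h
    rw [← hs, Nat.cast_le] at hT
    have hs1 : (s : ℝ) / f n ≤ 1 + ε := by
      rw [div_le_iff₀ hfn]
      exact (Nat.cast_le.mpr hT).trans (Nat.floor_le (by positivity))
    have hs2 : (s : ℝ) / f n ≤ 1 - ε' := by
      rcases lt_abs.mp hdev with h | h
      · linarith
      · have : ε' ≤ ε := min_le_left _ _
        linarith
    rw [div_le_iff₀ hfn] at hs2
    refine covered_of_coveringTime_le ?_
    rw [← hs, Nat.cast_le]
    exact Nat.le_floor hs2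
  · exact Or.inl hc

/-- Sharp concentration depends on the centering only up to asymptotic equivalence. -/
lemma SharplyConcentrated.congr_ratio {Ω : ℕ → Type*} [∀ n, MeasurableSpace (Ω n)]
    {P : ∀ n, Measure (Ω n)} {Y : ∀ n, Ω n → ℕ∞} {f g : ℕ → ℝ}
    (h : SharplyConcentrated P Y f) (hf : ∀ᶠ n in atTop, f n ≠ 0)
    (hfg : Tendsto (fun n => f n / g n) atTop (𝓝 1)) : SharplyConcentrated P Y g := by
  intro ε hε
  refine tendsto_of_tendsto_of_tendsto_of_le_of_le' tendsto_const_nhds (h (ε / 4) (by positivity))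
    (.of_forall fun _ => zero_le) ?_
  -- The bound 1 gives `|f/g| ≤ 2`, so the error is at most `(ε/4) * 2 + ε/2 = ε`.
  filter_upwards [hf, Metric.tendsto_nhds.mp hfg (min (ε / 2) 1) (by positivity)] with n hfn hr
  refine measure_mono fun ω hω => hω.imp id fun hdev => ?_
  rw [Real.dist_eq, lt_min_iff] at hr
  set T : ℝ := ((Y n ω).toNat : ℝ)
  by_contra hle
  rw [not_lt] at hle
  have e : T / g n - 1 = (T / f n - 1) * (f n / g n) + (f n / g n - 1) := by
    field_simp
    ring
  have hr2 : |f n / g n| ≤ 2 := by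
    have := abs_sub_abs_le_abs_sub (f n / g n) 1
    rw [abs_one] at this
    linarith
  have : |T / g n - 1| ≤ ε / 4 * 2 + ε / 2 := by
    rw [e]
    refine (abs_add_le _ _).trans (add_le_add ?_ hr.1.le)
    rw [abs_mul]
    exact mul_le_mul hle hr2 (abs_nonneg _) (by positivity)
  exact absurd hdev (not_lt.mpr (by linarith))

/-! ### Asymptotics of the centering and of the probability bounds. -/

section Asymptotics

lemma le_neg_log_one_sub {x : ℝ} (hx : x < 1) : x ≤ -Real.log (1 - x) := by
  linarith [Real.log_le_sub_one_of_pos (sub_pos.mpr hx)]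

lemma neg_log_one_sub_le {x : ℝ} (hx : x < 1) : -Real.log (1 - x) ≤ x / (1 - x) := by
  have hx' : 0 < 1 - x := sub_pos.mpr hx
  have h := Real.one_sub_inv_le_log_of_pos hx'
  have e : x / (1 - x) = (1 - x)⁻¹ - 1 := by field_simp; ring
  linarith

lemma tendsto_exp_neg_mul_log_natCast {c : ℝ} (hc : 0 < c) :
    Tendsto (fun n : ℕ => Real.exp (-(c * Real.log n))) atTop (𝓝 0) :=
  Real.tendsto_exp_neg_atTop_nhds_zero.comp
    ((Real.tendsto_log_atTop.comp tendsto_natCast_atTop_atTop).const_mul_atTop hc)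

lemma tendsto_zero_of_eventually_le_ofReal {u : ℕ → ENNReal} {r : ℕ → ℝ}
    (hr : Tendsto r atTop (𝓝 0)) (h : ∀ᶠ n in atTop, u n ≤ ENNReal.ofReal (r n)) :
    Tendsto u atTop (𝓝 0) := by
  have h' := ENNReal.tendsto_ofReal hr
  rw [ENNReal.ofReal_zero] at h'
  exact tendsto_of_tendsto_of_tendsto_of_le_of_le' tendsto_const_nhds h'
    (.of_forall fun _ => zero_le) h

variable {Ω₀ Ω : ℕ → Type*}
    [∀ n, MeasurableSpace (Ω₀ n)] [∀ n, MeasurableSpace (Ω n)]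
    {P₀ : ∀ n, Measure (Ω₀ n)} [∀ n, IsProbabilityMeasure (P₀ n)]
    {P : ∀ n, Measure (Ω n)} [∀ n, IsProbabilityMeasure (P n)]
    {X₀ : ∀ n, Ω₀ n → Finset (Fin n)} {X : ∀ n, ℕ → Ω n → Finset (Fin n)}

/-- The centering `log n / (-log (1 - μ / n))`. -/
noncomputable def center (μ : ℕ → ℝ) (n : ℕ) : ℝ := Real.log n / (-Real.log (1 - μ n / (n : ℝ)))

lemma center_pos {μ : ℕ → ℝ} {n : ℕ} (hn : 2 ≤ n) (h0 : 0 < μ n) (h1 : μ n < n) :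
    0 < center μ n := by
  have hn' : (0 : ℝ) < n := by positivity
  have hx : μ n / n < 1 := (div_lt_one hn').mpr h1
  exact div_pos (Real.log_pos (by exact_mod_cast hn))
    ((div_pos h0 hn').trans_le (le_neg_log_one_sub hx))

lemma center_le {μ : ℕ → ℝ} {n : ℕ} (hn : 2 ≤ n) (h0 : 0 < μ n) (h1 : μ n < n) :
    center μ n ≤ n * Real.log n / μ n := by
  have hn' : (0 : ℝ) < n := by positivity
  have hx : μ n / n < 1 := (div_lt_one hn').mpr h1
  have hl : 0 ≤ Real.log n := Real.log_natCast_nonneg n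
  calc center μ n ≤ Real.log n / (μ n / n) :=
        div_le_div_of_nonneg_left hl (div_pos h0 hn') (le_neg_log_one_sub hx)
    _ = n * Real.log n / μ n := by field_simp

/-- From `x ≤ -log (1 - x) ≤ x / (1 - x)` at `x = μ/n`, the ratio lies between `1 - μ/n` and 1. -/
lemma tendsto_center_ratio {μ : ℕ → ℝ} (hpos : ∀ᶠ n in atTop, 0 < μ n)
    (hμ : μ =o[atTop] fun n => (n : ℝ)) :
    Tendsto (fun n => center μ n / ((n : ℝ) * Real.log n / μ n)) atTop (𝓝 1) := by
  have hx : Tendsto (fun n => 1 - μ n / (n : ℝ)) atTop (𝓝 1) := by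
    simpa using hμ.tendsto_div_nhds_zero.const_sub 1
  have hlt := hx.eventually (lt_mem_nhds (zero_lt_one (α := ℝ)))
  refine tendsto_of_tendsto_of_tendsto_of_le_of_le' hx tendsto_const_nhds ?_ ?_ <;>
    filter_upwards [hlt, hpos, eventually_ge_atTop 2] with n hn h0 h2
  · have hn' : (0 : ℝ) < n := by positivity
    have hl : 0 < Real.log n := Real.log_pos (by exact_mod_cast h2)
    have hx1 : μ n / n < 1 := by linarith
    have hx0 : 0 < μ n / n := div_pos h0 hn'
    have hL := hx0.trans_le (le_neg_log_one_sub hx1)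
    rw [le_div_iff₀ (by positivity), center, le_div_iff₀ hL]
    calc (1 - μ n / n) * (n * Real.log n / μ n) * -Real.log (1 - μ n / n)
        ≤ (1 - μ n / n) * (n * Real.log n / μ n) * (μ n / n / (1 - μ n / n)) := by
          gcongr
          exact neg_log_one_sub_le hx1
      _ = Real.log n := by
          have hd : (n : ℝ) - μ n ≠ 0 := by
            have := (div_lt_one hn').mp hx1
            linarith
          field_simp
  · have hn' : (0 : ℝ) < n := by positivity
    have hl : 0 < Real.log n := Real.log_pos (by exact_mod_cast h2)
    rw [div_le_one (by positivity)]
    refine center_le h2 h0 ?_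
    rw [sub_pos, div_lt_one hn'] at hn
    exact hn

lemma tendsto_measure_not_covered (hX : ∀ n, IsCouponSequence (X₀ n) (P₀ n) (X n) (P n))
    (hexch : ∀ n, IsExchangeable (X₀ n) (P₀ n)) {μ : ℕ → ℝ}
    (hμ : ∀ n, μ n = meanSize (X₀ n) (P₀ n)) (hpos : ∀ᶠ n in atTop, 0 < μ n) {δ : ℝ}
    (hδ : 0 < δ) (hlt : ∀ᶠ n : ℕ in atTop, μ n < (1 - δ) * n) {ε : ℝ} (hε : 0 < ε) :
    Tendsto (fun n => P n {ω | covered (X n) ⌊(1 + ε) * center μ n⌋₊ ω ≠ Finset.univ})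
      atTop (𝓝 0) := by
  have hlim := (tendsto_exp_neg_mul_log_natCast hε).mul_const δ⁻¹
  rw [zero_mul] at hlim
  refine tendsto_zero_of_eventually_le_ofReal hlim ?_
  filter_upwards [hpos, hlt, eventually_ge_atTop 2] with n h0 h1 h2
  have hn : (0 : ℝ) < n := by positivity
  have : Nonempty (Fin n) := ⟨⟨0, by omega⟩⟩
  refine (measure_not_covered_le (hX n) (hexch n) _).trans (ENNReal.ofReal_le_ofReal ?_)
  rw [← hμ n, Fintype.card_fin]
  have hμn : μ n < n := by nlinarith
  have hx1 : μ n / n < 1 - δ := by rwa [div_lt_iff₀ hn]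
  have hx0 : 0 < μ n / n := div_pos h0 hn
  have hq : 0 < 1 - μ n / n := by linarith
  have hL := hx0.trans_le (le_neg_log_one_sub (by linarith : μ n / n < 1))
  set t := ⌊(1 + ε) * center μ n⌋₊
  -- Rounding loses at most one coupon, hence a factor `(1 - μ/n)⁻¹`; the gap `δ` keeps it below
  -- `δ⁻¹`.
  have ht : (1 + ε) * center μ n - 1 ≤ t := (Nat.sub_one_lt_floor _).le
  have hcL : center μ n * -Real.log (1 - μ n / n) = Real.log n := div_mul_cancel₀ _ hL.ne'
  have hpow : (1 - μ n / n) ^ t = Real.exp (-(t * -Real.log (1 - μ n / n))) := by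
    rw [mul_neg, neg_neg, Real.exp_nat_mul, Real.exp_log hq]
  have hmul := mul_le_mul_of_nonneg_right ht hL.le
  calc (n : ℝ) * (1 - μ n / n) ^ t
      = Real.exp (Real.log n - t * -Real.log (1 - μ n / n)) := by
        rw [hpow, sub_eq_add_neg (Real.log n), Real.exp_add, Real.exp_log hn]
    _ ≤ Real.exp (-(ε * Real.log n) + -Real.log (1 - μ n / n)) := by
        refine Real.exp_le_exp.mpr ?_
        linear_combination hmul - (1 + ε) * hcL
    _ = Real.exp (-(ε * Real.log n)) * (1 - μ n / n)⁻¹ := by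
        rw [Real.exp_add, Real.exp_neg (Real.log _), Real.exp_log hq]
    _ ≤ _ := by
        gcongr
        linarith

lemma tendsto_measure_covered_of_maxSize
    (hX : ∀ n, IsCouponSequence (X₀ n) (P₀ n) (X n) (P n))
    (hexch : ∀ n, IsExchangeable (X₀ n) (P₀ n)) {M μ : ℕ → ℝ}
    (hM : ∀ n, M n = maxSize (X₀ n) (P₀ n))
    (hμ : ∀ n, μ n = meanSize (X₀ n) (P₀ n)) (hpos : ∀ᶠ n in atTop, 0 < μ n)
    (hMn : M =o[atTop] fun n => (n : ℝ)) {ε : ℝ} (hε : 0 < ε) (hε1 : ε < 1) :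
    Tendsto (fun n => P n {ω | covered (X n) ⌊(1 - ε) * center μ n⌋₊ ω = Finset.univ})
      atTop (𝓝 0) := by
  refine tendsto_zero_of_eventually_le_ofReal
    (tendsto_exp_neg_mul_log_natCast (half_pos hε)) ?_
  filter_upwards [hpos, hMn.bound (half_pos hε), eventually_ge_atTop 2] with n h0 hb h2
  have hn : (0 : ℝ) < n := by positivity
  have hMb : M n ≤ ε / 2 * n := by
    simpa using (le_abs_self _).trans hb
  have hMn' : M n < n := by nlinarith
  have hμM : μ n ≤ M n := by
    rw [hμ, hM]; exact meanSize_le_maxSize ((hX n).identDistrib 0).aemeasurable_snd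
  refine (measure_covered_le_of_maxSize_lt (by simpa using h2) (hX n) (hexch n) ?_ _).trans
    (ENNReal.ofReal_le_ofReal ?_)
  · rw [Fintype.card_fin]
    rw [hM] at hMn'
    exact_mod_cast hMn'
  rw [← hμ n, ← hM n, Fintype.card_fin]
  set t := ⌊(1 - ε) * center μ n⌋₊
  have hl : 0 ≤ Real.log n := Real.log_natCast_nonneg n
  have ht : (t : ℝ) ≤ (1 - ε) * (n * Real.log n / μ n) :=
    (Nat.floor_le (mul_nonneg (by linarith) (center_pos h2 h0 (by linarith)).le)).trans
      (mul_le_mul_of_nonneg_left (center_le h2 h0 (by linarith)) (by linarith))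
  have hd : 0 < n - M n := by linarith
  have hexp : t * (μ n / (n - M n)) ≤ (1 - ε / 2) * Real.log n := by
    calc t * (μ n / (n - M n))
        ≤ (1 - ε) * (n * Real.log n / μ n) * (μ n / (n - M n)) := by gcongr
      _ = (1 - ε) * n / (n - M n) * Real.log n := by field_simp
      _ ≤ (1 - ε / 2) * Real.log n := by
        refine mul_le_mul_of_nonneg_right ?_ hl
        rw [div_le_iff₀ hd]
        -- Since `M ≤ (ε/2) n`, it is enough that `1 - ε ≤ (1 - ε/2)²`.
        have : (1 - ε / 2) * ((1 - ε / 2) * n) ≤ (1 - ε / 2) * (n - M n) :=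
          mul_le_mul_of_nonneg_left (by linarith) (by linarith)
        nlinarith [mul_nonneg (sq_nonneg ε) hn.le]
  calc Real.exp (t * (μ n / (n - M n))) / n
      ≤ Real.exp ((1 - ε / 2) * Real.log n) / n := by gcongr
    _ = Real.exp ((1 - ε / 2) * Real.log n) / Real.exp (Real.log n) := by rw [Real.exp_log hn]
    _ = Real.exp (-(ε / 2 * Real.log n)) := by rw [← Real.exp_sub]; ring_nf

lemma tendsto_measure_covered_of_variance
    (hX : ∀ n, IsCouponSequence (X₀ n) (P₀ n) (X n) (P n))
    (hexch : ∀ n, IsExchangeable (X₀ n) (P₀ n)) {μ χ η : ℕ → ℝ}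
    (hμ : ∀ n, μ n = meanSize (X₀ n) (P₀ n)) (hχ : ∀ n, χ n = meanSqSize (X₀ n) (P₀ n))
    (hpos : ∀ᶠ n in atTop, 0 < μ n) {δ : ℝ}
    (hδ : 0 < δ) (hlt : ∀ᶠ n : ℕ in atTop, μ n < (1 - δ) * n)
    (hη : η =o[atTop] fun n => 1 / (μ n * (n : ℝ) * Real.log n))
    (hχη : ∀ᶠ n in atTop, χ n = (1 + η n) * μ n ^ 2) {ε : ℝ} (hε : 0 < ε) (hε1 : ε < 1) :
    Tendsto (fun n => P n {ω | covered (X n) ⌊(1 - ε) * center μ n⌋₊ ω = Finset.univ})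
      atTop (𝓝 0) := by
  have hlim2 : Tendsto (fun n : ℕ => Real.exp (2 / δ ^ 2 * (n : ℝ)⁻¹) - 1) atTop (𝓝 0) := by
    have h := (tendsto_inv_atTop_nhds_zero_nat (𝕜 := ℝ)).const_mul (2 / δ ^ 2)
    rw [mul_zero] at h
    have h' := ((Real.continuous_exp.tendsto _).comp h).sub_const 1
    rwa [Real.exp_zero, sub_self] at h'
  have hlim := (tendsto_exp_neg_mul_log_natCast hε).add hlim2
  rw [add_zero] at hlim
  refine tendsto_zero_of_eventually_le_ofReal hlim ?_
  filter_upwards [hpos, hlt, hη.bound one_pos, hχη, eventually_ge_atTop 2] with n h0 h1 hb he h2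
  have hn : (0 : ℝ) < n := by positivity
  have hn1 : (1 : ℝ) ≤ n := by exact_mod_cast (by omega : 1 ≤ n)
  have hl : 0 < Real.log n := Real.log_pos (by exact_mod_cast h2)
  have hμn : μ n < n := by nlinarith
  have hηle : η n ≤ 1 / (μ n * n * Real.log n) := by
    have := (le_abs_self _).trans hb
    rwa [one_mul, Real.norm_of_nonneg (by positivity)] at this
  refine (measure_covered_le_of_variance (by simpa using h2) (hX n) (hexch n)
    (by rwa [← hμ n, Fintype.card_fin]) _).trans (ENNReal.ofReal_le_ofReal ?_)
  rw [← hμ n, ← hχ n, Fintype.card_fin, he]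
  have hx1 : μ n / n < 1 := (div_lt_one hn).mpr hμn
  have hx0 : 0 < μ n / n := div_pos h0 hn
  have hq : 0 < 1 - μ n / n := by linarith
  have hL := hx0.trans_le (le_neg_log_one_sub hx1)
  set t := ⌊(1 - ε) * center μ n⌋₊
  have hcpos := center_pos h2 h0 hμn
  have ht : (t : ℝ) ≤ (1 - ε) * center μ n :=
    Nat.floor_le (mul_nonneg (by linarith) hcpos.le)
  have ht' : (t : ℝ) ≤ n * Real.log n / μ n := by
    have := center_le h2 h0 hμn
    nlinarith
  have hcL : center μ n * -Real.log (1 - μ n / n) = Real.log n := div_mul_cancel₀ _ hL.ne'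
  refine add_le_add ?_ (sub_le_sub_right (Real.exp_le_exp.mpr ?_) 1)
  · have hpow : ((1 - μ n / n)⁻¹) ^ t = Real.exp (t * -Real.log (1 - μ n / n)) := by
      rw [Real.exp_nat_mul, Real.exp_neg, Real.exp_log hq]
    have hmul := mul_le_mul_of_nonneg_right ht hL.le
    calc ((1 - μ n / n)⁻¹) ^ t / n
        = Real.exp (t * -Real.log (1 - μ n / n) - Real.log n) := by
          rw [hpow, Real.exp_sub, Real.exp_log hn]
      _ ≤ Real.exp (-(ε * Real.log n)) := by
          refine Real.exp_le_exp.mpr ?_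
          linear_combination hmul + (1 - ε) * hcL
  · have hd : 0 < n - μ n := by linarith
    have hdδ : δ * n ≤ n - μ n := by linarith
    -- With `t ≤ n log n / μ` and `n - μ ≥ δ n`, the bound on `η` cancels `μ` and `log n`, leaving
    -- order `n⁻²`.
    calc t * (2 * ((1 + η n) * μ n ^ 2 - μ n ^ 2) / (n - μ n) ^ 2)
        = 2 * t * μ n ^ 2 / (n - μ n) ^ 2 * η n := by ring
      _ ≤ 2 * t * μ n ^ 2 / (n - μ n) ^ 2 * (1 / (μ n * n * Real.log n)) := by gcongr
      _ ≤ 2 * (n * Real.log n / μ n) * μ n ^ 2 / (δ * n) ^ 2 * (1 / (μ n * n * Real.log n)) := by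
          gcongr
      _ = 2 / δ ^ 2 * ((n : ℝ)⁻¹ * (n : ℝ)⁻¹) := by field_simp
      _ ≤ 2 / δ ^ 2 * (n : ℝ)⁻¹ := by
          gcongr
          exact mul_le_of_le_one_left (by positivity) (inv_le_one_of_one_le₀ hn1)

lemma isLittleO_natCast_of_isLittleO_sqrt {M : ℕ → ℝ}
    (h : M =o[atTop] fun n : ℕ => Real.sqrt ((n : ℝ) * Real.log n)) :
    M =o[atTop] fun n => (n : ℝ) := by
  refine h.trans_isBigO (.of_bound 1 (.of_forall fun n => ?_))
  rw [one_mul, Real.norm_of_nonneg (Real.sqrt_nonneg _), Real.norm_of_nonneg (Nat.cast_nonneg n)]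
  refine Real.sqrt_le_iff.mpr ⟨Nat.cast_nonneg n, ?_⟩
  rw [sq]
  exact mul_le_mul_of_nonneg_left (Real.log_le_self (Nat.cast_nonneg n)) (Nat.cast_nonneg n)

end Asymptotics

end CouponCollector

/-! ### Reduction of the four conditions to two regimes, and conclusion. -/

theorem mainTheorem5 {Ω₀ Ω : ℕ → Type*}
    [∀ n, MeasurableSpace (Ω₀ n)] [∀ n, MeasurableSpace (Ω n)]
    (P₀ : ∀ n, Measure (Ω₀ n)) [∀ n, IsProbabilityMeasure (P₀ n)]
    (P : ∀ n, Measure (Ω n)) [∀ n, IsProbabilityMeasure (P n)]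
    (X₀ : ∀ n, Ω₀ n → Finset (Fin n)) (X : ∀ n, ℕ → Ω n → Finset (Fin n))
    (hX : ∀ n, CouponCollector.IsCouponSequence (X₀ n) (P₀ n) (X n) (P n))
    (hexch : ∀ n, CouponCollector.IsExchangeable (X₀ n) (P₀ n))
    (M μ χ : ℕ → ℝ)
    (hM : ∀ n, M n = (CouponCollector.maxSize (X₀ n) (P₀ n) : ℝ))
    (hμ : ∀ n, μ n = CouponCollector.meanSize (X₀ n) (P₀ n))
    (hχ : ∀ n, χ n = CouponCollector.meanSqSize (X₀ n) (P₀ n))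
    (hpos : ∀ᶠ n in atTop, 0 < μ n)
    (hcond :
      (M =o[atTop] fun n => Real.sqrt ((n : ℝ) * Real.log n)) ∨
      ((M =o[atTop] fun n => (n : ℝ)) ∧
        M =o[atTop] fun n => Real.sqrt (μ n * (n : ℝ) * Real.log n)) ∨
      ((M =o[atTop] fun n => (n : ℝ)) ∧
        χ =o[atTop] fun n => μ n * (n : ℝ) * Real.log n) ∨
      ((∃ δ : ℝ, 0 < δ ∧ ∀ᶠ n : ℕ in atTop, μ n < (1 - δ) * (n : ℝ)) ∧
        ∃ η : ℕ → ℝ, (η =o[atTop] fun n => 1 / (μ n * (n : ℝ) * Real.log n)) ∧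
          ∀ᶠ n in atTop, χ n = (1 + η n) * μ n ^ 2)) :
    CouponCollector.SharplyConcentrated P (fun n => CouponCollector.coveringTime (X n))
        (fun n => Real.log n / (-Real.log (1 - μ n / (n : ℝ)))) ∧
      ((μ =o[atTop] fun n => (n : ℝ)) →
        CouponCollector.SharplyConcentrated P (fun n => CouponCollector.coveringTime (X n))
          (fun n => (n : ℝ) * Real.log n / μ n)) := by
  have hcenter : (fun n : ℕ => Real.log n / (-Real.log (1 - μ n / (n : ℝ)))) =
      CouponCollector.center μ := rfl
  have hcases : (M =o[atTop] fun n => (n : ℝ)) ∨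
      ((∃ δ : ℝ, 0 < δ ∧ ∀ᶠ n : ℕ in atTop, μ n < (1 - δ) * (n : ℝ)) ∧
        ∃ η : ℕ → ℝ, (η =o[atTop] fun n => 1 / (μ n * (n : ℝ) * Real.log n)) ∧
          ∀ᶠ n in atTop, χ n = (1 + η n) * μ n ^ 2) := by
    rcases hcond with h | h | h | h
    · exact .inl (CouponCollector.isLittleO_natCast_of_isLittleO_sqrt h)
    · exact .inl h.1
    · exact .inl h.1
    · exact .inr h
  -- Both regimes keep `μ/n` away from 1: either by assumption, or because `μ ≤ M = o(n)`. The upper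
  -- bound on `T` and the positivity of the centering rely on this.
  have hgap : ∃ δ : ℝ, 0 < δ ∧ ∀ᶠ n : ℕ in atTop, μ n < (1 - δ) * (n : ℝ) := by
    rcases hcases with h | h
    · refine ⟨1 / 2, by norm_num, ?_⟩
      filter_upwards [h.bound (show (0 : ℝ) < 1 / 4 by norm_num), eventually_ge_atTop 1]
        with n hb hn
      have hn' : (1 : ℝ) ≤ n := by exact_mod_cast hn
      have hM' : M n ≤ 1 / 4 * n := by simpa using (le_abs_self _).trans hb
      have hμM : μ n ≤ M n := by
        rw [hμ, hM]
        exact CouponCollector.meanSize_le_maxSize ((hX n).identDistrib 0).aemeasurable_snd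
      linarith
    · exact h.1
  obtain ⟨δ, hδ, hlt⟩ := hgap
  have hcpos : ∀ᶠ n in atTop, 0 < CouponCollector.center μ n := by
    filter_upwards [hpos, hlt, eventually_ge_atTop 2] with n h0 h1 h2
    refine CouponCollector.center_pos h2 h0 (h1.trans_le ?_)
    nlinarith [Nat.cast_nonneg (α := ℝ) n]
  have hmain : CouponCollector.SharplyConcentrated P
      (fun n => CouponCollector.coveringTime (X n)) (CouponCollector.center μ) := by
    refine CouponCollector.sharplyConcentrated_coveringTime hcpos
      (fun ε hε => CouponCollector.tendsto_measure_not_covered hX hexch hμ hpos hδ hlt hε)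
      fun ε hε hε1 => ?_
    rcases hcases with h | ⟨_, η, hη, hχη⟩
    · exact CouponCollector.tendsto_measure_covered_of_maxSize hX hexch hM hμ hpos h hε hε1
    · exact CouponCollector.tendsto_measure_covered_of_variance hX hexch hμ hχ hpos hδ hlt hη hχη
        hε hε1
  rw [hcenter]
  exact ⟨hmain, fun h => hmain.congr_ratio (hcpos.mono fun n hn => hn.ne')
    (CouponCollector.tendsto_center_ratio hpos h)⟩
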